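/- **Setting.** A signature is a set of operators with ranks; $\mathsf T(\Sigma)$ is the set of closed terms (processes) over a signature $\Sigma$, and $\Delta(\mathsf T(\Sigma))$ the set of discrete probability distributions on it. A PGSOS specification $P=(\Sigma,A,R)$ consists of a signature $\Sigma$, a set $A$ of actions and a set $R$ of rules $$\frac{\{x_i\xrightarrow{a_{i,k}}\mu_{i,k}\}_{1\le i\le n,\,k\in K_i}\qquad\{x_i\not\xrightarrow{b_{i,l}}\}_{1\le i\le n,\,l\in L_i}}{f(x_1,\dots,x_n)\xrightarrow{a}\theta}$$ with $K_i,L_i$ finite, $x_i$ and $\mu_{i,k}$ pairwise different state and distribution variables, and $\theta$ a distribution term in these variables (built from distribution variables, Dirac distributions $\delta(t)$ of state terms $t$, convex combinations with positive weights, and products $f(\theta_1,\dots,\theta_m)$ with $f\in\Sigma$), such that for all $f\in\Sigma$ and $a\in A$ only finitely many rules have source operator $f$ and conclusion label $a$. It induces a unique supported transition relation ${\to}\subseteq\mathsf T(\Sigma)\times A\times\Delta(\mathsf T(\Sigma))$, i.e. one that contains exactly the transitions that are conclusions of closed rule instances whose premises hold. For a function $d\colon\mathsf T(\Sigma)^2\to[0,1]$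 let $\mathbf K(d)(\pi,\pi')=\inf_\omega\sum_{t,t'}d(t,t')\,\omega(t,t')$, with $\omega$ ranging over the distributions on $\mathsf T(\Sigma)^2$ with marginals $\pi,\pi'$. For $\lambda\in(0,1]$, a pseudometric $d\colon\mathsf T(\Sigma)^2\to[0,1]$ is a $\lambda$-bisimulation metric if, whenever $d(s,t)<1$ and $s\xrightarrow{a}\pi$, there is $t\xrightarrow{a}\pi'$ with $\lambda\,\mathbf K(d)(\pi,\pi')\le d(s,t)$. The $\lambda$-bisimilarity metric $\mathbf d$ is the smallest $\lambda$-bisimulation metric in the pointwise order. An operator $f\in\Sigma$ of rank $n$ is non-extensive w.r.t. $\mathbf d$ if $\mathbf d(f(s_1,\dots,s_n),f(t_1,\dots,t_n))\le\max_{1\le i\le n}\mathbf d(s_i,t_i)$ for all $s_i,t_i\in\mathsf T(\Sigma)$. Let $\surd\in A$ denote successful termination, and let $P_{\mathrm{PA}}$ be the specification of the following operators: the stop process $0$ (no rules); the skip process $\varepsilon$ with $\varepsilon\xrightarrow{\surd}\delta(0)$; probabilistic action prefix $a.\bigoplus_{i=1}^n[p_i]\_$ ($a\in A$, $n\ge1$,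 $p_i\in(0,1]$, $\sum_ip_i=1$) with the rule $$a.\bigoplus_{i=1}^n[p_i]x_i\xrightarrow{a}\sum_{i=1}^np_i\,\delta(x_i);$$ nondeterministic alternative composition $\_+\_$ with the rules, for all $a\in A$, $$\frac{x\xrightarrow{a}\mu}{x+y\xrightarrow{a}\mu}\qquad\frac{y\xrightarrow{a}\nu}{x+y\xrightarrow{a}\nu};$$ probabilistic alternative composition $\_+_p\_$ ($p\in(0,1)$) with the rules, for all $a\in A$, $$\frac{x\xrightarrow{a}\mu\quad y\not\xrightarrow{a}}{x+_py\xrightarrow{a}\mu}\qquad\frac{x\not\xrightarrow{a}\quad y\xrightarrow{a}\nu}{x+_py\xrightarrow{a}\nu}\qquad\frac{x\xrightarrow{a}\mu\quad y\xrightarrow{a}\nu}{x+_py\xrightarrow{a}p\,\mu+(1-p)\,\nu};$$ and further the following binary operators. Sequential composition $;$ has the rules $$\frac{x\xrightarrow{a}\mu}{x;y\xrightarrow{a}\mu;\delta(y)}\ (a\ne\surd)\qquad\frac{x\xrightarrow{\surd}\mu\quad y\xrightarrow{a}\nu}{x;y\xrightarrow{a}\nu}.$$ Each parallel operator $\|'$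 among synchronous $\mid$, asynchronous $\mid\mid\mid$, probabilistic $\mid\mid\mid_p$ ($p\in(0,1)$) and CSP-like $\parallel_B$ ($B\subseteq A$) has the rule that $x\xrightarrow{\surd}\mu$ and $y\xrightarrow{\surd}\nu$ give $x\,\|'\,y\xrightarrow{\surd}\delta(0)$. The remaining rules are, for $a\neq\surd$: for $\mid$, and for $\parallel_B$ if $a\in B$, that $x\xrightarrow{a}\mu$ and $y\xrightarrow{a}\nu$ give target $\mu\,\|'\,\nu$; for $\mid\mid\mid$, and for $\parallel_B$ if $a\notin B$, that $x\xrightarrow{a}\mu$ gives target $\mu\,\|'\,\delta(y)$ and that $y\xrightarrow{a}\nu$ gives target $\delta(x)\,\|'\,\nu$; for $\mid\mid\mid_p$, that $x\xrightarrow{a}\mu$, $y\not\xrightarrow{a}$ give target $\mu\mid\mid\mid_p\delta(y)$, that $x\not\xrightarrow{a}$, $y\xrightarrow{a}\nu$ give target $\delta(x)\mid\mid\mid_p\nu$, and that $x\xrightarrow{a}\mu$, $y\xrightarrow{a}\nu$ give target $p\,(\mu\mid\mid\mid_p\delta(y))+(1-p)\,(\delta(x)\mid\mid\mid_p\nu)$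 (the conclusion being labelled $a$ in all cases). **Theorem.** Let $P=(\Sigma,A,R)$ be any PGSOS specification that is a disjoint extension of $P_{\mathrm{PA}}$, i.e. it contains the operators and rules of $P_{\mathrm{PA}}$ and has no further rules for these operators. Let $\lambda\in(0,1]$. Then the $\lambda$-bisimilarity metric $\mathbf d$ on $\mathsf T(\Sigma)$ exists, and the operators probabilistic action prefix $a.\bigoplus_{i=1}^n[p_i]\_$, nondeterministic alternative composition $\_+\_$ and probabilistic alternative composition $\_+_p\_$ are non-extensive w.r.t. $\mathbf d$: for all $s_i,t_i\in\mathsf T(\Sigma)$, $$\mathbf d\Big(a.\bigoplus_{i=1}^n[p_i]s_i,\;a.\bigoplus_{i=1}^n[p_i]t_i\Big)\le\max_{1\le i\le n}\mathbf d(s_i,t_i),$$ $$\mathbf d(s_1+s_2,\,t_1+t_2)\le\max(\mathbf d(s_1,t_1),\mathbf d(s_2,t_2)),\qquad\mathbf d(s_1+_ps_2,\,t_1+_pt_2)\le\max(\mathbf d(s_1,t_1),\mathbf d(s_2,t_2)).$$ -/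

import Mathlib

open scoped NNReal ENNReal

universe u v w

noncomputable section

/-! ### Signatures, state terms, distributions and distribution terms -/

/-- A signature: `Op n` is the set of operators of rank `n`. -/
structure Signature where
  Op : ℕ → Type u

/-- State terms over a signature `S` and a set `V` of state variables. -/
inductive Term (S : Signature.{u}) (V : Type) : Type u
  | var (x : V) : Term S V
  | op {n : ℕ} (f : S.Op n) (ts : Fin n → Term S V) : Term S V

/-- Closed state terms (processes). -/
abbrev Proc (S : Signature.{u}) : Type u := Term S Empty

/-- Simultaneous substitution of state terms for state variables. -/
def Term.subst {S : Signature.{u}} {V W : Type} (σ : V → Term S W) : Term S V → Term S W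
  | .var x => σ x
  | .op f ts => .op f (fun i => (ts i).subst σ)

/-- Product distribution on `n`-tuples; `piPMF_apply` gives the usual formula. -/
def piPMF {X : Type u} : (n : ℕ) → (Fin n → PMF X) → PMF (Fin n → X)
  | 0, _ => PMF.pure Fin.elim0
  | n + 1, π => (π 0).bind fun x => (piPMF n fun i => π i.succ).map (Fin.cons x)

theorem piPMF_apply {X : Type u} (n : ℕ) (π : Fin n → PMF X) (t : Fin n → X) :
    piPMF n π t = ∏ i, π i (t i) := by
  classical
  induction n with
  | zero => simp [piPMF, PMF.pure_apply, Subsingleton.elim t Fin.elim0]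
  | succ n ih =>
    rw [piPMF, PMF.bind_apply, tsum_eq_single (t 0), PMF.map_apply, tsum_eq_single (Fin.tail t),
      Fin.prod_univ_succ, ih]
    · simp [Fin.cons_self_tail, Fin.tail]
    · intro s hs
      rw [if_neg]
      intro h
      exact hs (by rw [h, Fin.tail_cons])
    · intro x hx
      rw [PMF.map_apply, ENNReal.tsum_eq_zero.2, mul_zero]
      intro s
      rw [if_neg]
      intro h
      exact hx (by rw [h, Fin.cons_zero])

/-- The distribution `f(π₁,…,πₙ)` on closed terms, image of the product distribution under the
operator `f`. -/
def opPMF {S : Signature.{u}} {n : ℕ} (f : S.Op n) (π : Fin n → PMF (Proc S)) : PMF (Proc S) :=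
  (piPMF n π).map (Term.op f)

/-- Distribution terms over a signature `S`, a set `V` of state variables and a set `D` of
distribution variables. Convex combinations have positive weights with sum `1`. -/
inductive DTerm (S : Signature.{u}) (V D : Type) : Type (max 1 u)
  | var (μ : D) : DTerm S V D
  | dirac (t : Term S V) : DTerm S V D
  | sum (I : Type) (p : PMF I) (hp : ∀ i, p i ≠ 0) (θ : I → DTerm S V D) : DTerm S V D
  | op {n : ℕ} (f : S.Op n) (θ : Fin n → DTerm S V D) : DTerm S V D

/-- The distribution denoted by the instance of a distribution term under the closed substitution
that sends the state variables to processes and the distribution variables to distributions. -/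
def DTerm.eval {S : Signature.{u}} {V D : Type} (σ : V → Proc S) (ρ : D → PMF (Proc S)) :
    DTerm S V D → PMF (Proc S)
  | .var μ => ρ μ
  | .dirac t => PMF.pure (t.subst σ)
  | .sum _ p _ θ => p.bind fun i => (θ i).eval σ ρ
  | .op f θ => opPMF f fun i => (θ i).eval σ ρ

/-- Translation of state terms along a rank preserving map of operators. -/
def Term.mapOp {S₁ : Signature.{u}} {S₂ : Signature.{v}} {V : Type}
    (e : ∀ n, S₁.Op n → S₂.Op n) : Term S₁ V → Term S₂ V
  | .var x => .var x
  | .op f ts => .op (e _ f) fun i => (ts i).mapOp e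

/-- Translation of distribution terms along a rank preserving map of operators. -/
def DTerm.mapOp {S₁ : Signature.{u}} {S₂ : Signature.{v}} {V D : Type}
    (e : ∀ n, S₁.Op n → S₂.Op n) : DTerm S₁ V D → DTerm S₂ V D
  | .var μ => .var μ
  | .dirac t => .dirac (t.mapOp e)
  | .sum I p hp θ => .sum I p hp fun i => (θ i).mapOp e
  | .op f θ => .op (e _ f) fun i => (θ i).mapOp e

/-! ### Probabilistic transition systems and bisimulation metrics -/

/-- A probabilistic nondeterministic labelled transition system with states `X` and actions `A`:
`M t a π` means that `t` has an `a`-labelled transition to the distribution `π`. -/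
abbrev PTS (X : Type u) (A : Type w) := X → A → PMF X → Prop

/-- `1`-bounded pseudometrics. -/
structure IsPseudometric {X : Type u} (d : X → X → ℝ≥0∞) : Prop where
  le_one : ∀ s t, d s t ≤ 1
  self : ∀ t, d t t = 0
  symm : ∀ s t, d s t = d t s
  triangle : ∀ s t r, d s t ≤ d s r + d r t

/-- Matchings of two distributions. -/
def matchings {X : Type u} (π π' : PMF X) : Set (PMF (X × X)) :=
  {ω | ω.map Prod.fst = π ∧ ω.map Prod.snd = π'}

/-- Kantorovich lifting. -/
def kantorovich {X : Type u} (d : X → X → ℝ≥0∞) (π π' : PMF X) : ℝ≥0∞ :=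
  ⨅ ω ∈ matchings π π', ∑' x : X × X, d x.1 x.2 * ω x

/-- `lam`-bisimulation metrics on a PTS. -/
structure IsBisimulationMetric {X : Type u} {A : Type w} (M : PTS X A) (lam : ℝ≥0)
    (d : X → X → ℝ≥0∞) : Prop where
  pseudometric : IsPseudometric d
  transfer : ∀ s t, d s t < 1 → ∀ a π, M s a π →
    ∃ π', M t a π' ∧ (lam : ℝ≥0∞) * kantorovich d π π' ≤ d s t

/-- The `lam`-bisimilarity metric: the infimum of all `lam`-bisimulation metrics in the pointwise
order. -/
def bisimilarityMetric {X : Type u} {A : Type w} (M : PTS X A) (lam : ℝ≥0) : X → X → ℝ≥0∞ :=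
  sInf {d | IsBisimulationMetric M lam d}

/-- Non-extensiveness of an operator with respect to a distance on processes. -/
def NonExtensive {S : Signature.{u}} (d : Proc S → Proc S → ℝ≥0∞) {n : ℕ} (f : S.Op n) : Prop :=
  ∀ s t : Fin n → Proc S, d (.op f s) (.op f t) ≤ ⨆ i, d (s i) (t i)

/-! ### PGSOS specifications -/

/-- A PGSOS rule for an operator of rank `n`. The source variables are `x₀,…,xₙ₋₁`, indexed by
`Fin n`. The `j`-th positive premise `x_i -a→ μ_j`, where `pos j = (i, a)`, has its own
distribution variable `μ_j`. The `l`-th negative premise is that `x_i` has no `b`-transition, where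
`neg l = (i, b)`. The target contains no other variables. -/
structure Rule (S : Signature.{u}) (A : Type w) (n : ℕ) where
  numPos : ℕ
  pos : Fin numPos → Fin n × A
  numNeg : ℕ
  neg : Fin numNeg → Fin n × A
  act : A
  target : DTerm S (Fin n) (Fin numPos)

/-- Translation of rules along a rank preserving map of operators. -/
def Rule.mapOp {S₁ : Signature.{u}} {S₂ : Signature.{v}} {A : Type w} {n : ℕ}
    (e : ∀ n, S₁.Op n → S₂.Op n) (r : Rule S₁ A n) : Rule S₂ A n where
  numPos := r.numPos
  pos := r.pos
  numNeg := r.numNeg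
  neg := r.neg
  act := r.act
  target := r.target.mapOp e

/-- A probabilistic transition system specification in PGSOS format with actions `A`. The set
`rules f` consists of the rules with source operator `f`. -/
structure PTSS (A : Type w) where
  sig : Signature.{u}
  rules : ∀ {n : ℕ}, sig.Op n → Set (Rule sig A n)
  finite_rules : ∀ {n : ℕ} (f : sig.Op n) (a : A), {r ∈ rules f | r.act = a}.Finite

/-- `P.Supports M t a π`: some rule of `P` has an instance with conclusion `t -a→ π` whose premises
hold in `M`. -/
def PTSS.Supports {A : Type w} (P : PTSS.{u} A) (M : PTS (Proc P.sig) A)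
    (t : Proc P.sig) (a : A) (π : PMF (Proc P.sig)) : Prop :=
  ∃ (n : ℕ) (f : P.sig.Op n), ∃ r ∈ P.rules f,
    ∃ (σ : Fin n → Proc P.sig) (ρ : Fin r.numPos → PMF (Proc P.sig)),
      (∀ j, M (σ (r.pos j).1) (r.pos j).2 (ρ j)) ∧
      (∀ l π', ¬ M (σ (r.neg l).1) (r.neg l).2 π') ∧
      t = .op f σ ∧ a = r.act ∧ π = r.target.eval σ ρ

/-- Supported models: exactly the transitions justified by the rules are present. -/
def PTSS.IsSupportedModel {A : Type w} (P : PTSS.{u} A) (M : PTS (Proc P.sig) A) : Prop :=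
  ∀ t a π, M t a π ↔ P.Supports M t a π

/-- The induced model, by recursion on the source term. It is the unique supported model, see
`PTSS.isSupportedModel_iff`. -/
def PTSS.model {A : Type w} (P : PTSS.{u} A) : PTS (Proc P.sig) A
  | .op f ts => fun a π => ∃ r ∈ P.rules f, ∃ ρ : Fin r.numPos → PMF (Proc P.sig),
      (∀ j, P.model (ts (r.pos j).1) (r.pos j).2 (ρ j)) ∧
      (∀ l π', ¬ P.model (ts (r.neg l).1) (r.neg l).2 π') ∧
      a = r.act ∧ π = r.target.eval ts ρ

theorem PTSS.isSupportedModel_iff {A : Type w} (P : PTSS.{u} A) (M : PTS (Proc P.sig) A) :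
    P.IsSupportedModel M ↔ M = P.model := by
  constructor
  · intro h
    funext t
    induction t with
    | var x => exact x.elim
    | op f ts ih =>
      funext a π
      rw [PTSS.model]
      refine propext ((h _ _ _).trans ⟨?_, ?_⟩)
      · rintro ⟨n, g, r, hr, σ, ρ, hp, hn, ht, ha, hπ⟩
        cases ht
        exact ⟨r, hr, ρ, fun j => ih _ ▸ hp j, fun l π' => ih _ ▸ hn l π', ha, hπ⟩
      · rintro ⟨r, hr, ρ, hp, hn, ha, hπ⟩
        exact ⟨_, f, r, hr, ts, ρ, fun j => (ih _).symm ▸ hp j,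
          fun l π' => (ih _).symm ▸ hn l π', rfl, ha, hπ⟩
  · rintro rfl t a π
    cases t with
    | var x => exact x.elim
    | op f ts =>
      rw [PTSS.model]
      constructor
      · rintro ⟨r, hr, ρ, hp, hn, ha, hπ⟩
        exact ⟨_, f, r, hr, ts, ρ, hp, hn, rfl, ha, hπ⟩
      · rintro ⟨n, g, r, hr, σ, ρ, hp, hn, ht, ha, hπ⟩
        cases ht
        exact ⟨r, hr, ρ, hp, hn, ha, hπ⟩

/-- `P₂` is a disjoint extension of `P₁`: the operators of `P₁` are operators of `P₂` of the same
rank, and `P₂` has for them exactly the rules of `P₁`. -/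
structure DisjointExtension {A : Type w} (P₁ : PTSS.{u} A) (P₂ : PTSS.{v} A) where
  emb : ∀ n, P₁.sig.Op n → P₂.sig.Op n
  emb_injective : ∀ n, Function.Injective (emb n)
  rules_emb : ∀ {n : ℕ} (f : P₁.sig.Op n), P₂.rules (emb n f) = Rule.mapOp emb '' P₁.rules f

/-! ### The probabilistic process algebra -/

/-- Operators of the probabilistic process algebra over the actions `A`. -/
inductive PAOp (A : Type w) : ℕ → Type w
  /-- the stop process `0` -/
  | nil : PAOp A 0
  /-- the skip process `ε` -/
  | skip : PAOp A 0
  /-- probabilistic action prefix `a.([p₁]_ ⊕ … ⊕ [pₙ]_)`; a `PMF` on `Fin n` forces `1 ≤ n` -/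
  | pre {n : ℕ} (a : A) (p : PMF (Fin n)) (hp : ∀ i, p i ≠ 0) : PAOp A n
  /-- sequential composition -/
  | seq : PAOp A 2
  /-- nondeterministic alternative composition `_ + _` -/
  | alt : PAOp A 2
  /-- probabilistic alternative composition `_ +_p _` -/
  | palt (p : Set.Ioo (0 : ℝ≥0) 1) : PAOp A 2
  /-- synchronous parallel composition `_ | _` -/
  | sync : PAOp A 2
  /-- asynchronous parallel composition `_ ||| _` -/
  | async : PAOp A 2
  /-- probabilistic parallel composition `_ |||_p _` -/
  | pasync (p : Set.Ioo (0 : ℝ≥0) 1) : PAOp A 2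
  /-- CSP-like parallel composition `_ ∥_B _` -/
  | csp (B : Set A) : PAOp A 2

/-- The signature of the probabilistic process algebra. -/
def paSig (A : Type w) : Signature.{w} := ⟨PAOp A⟩

section PA

variable {A : Type w} {V D : Type}

/-- The distribution term `f(θ₁, θ₂)` for a binary operator `f`. -/
def DTerm.bin (f : PAOp A 2) (θ₁ θ₂ : DTerm (paSig A) V D) : DTerm (paSig A) V D :=
  .op (S := paSig A) f ![θ₁, θ₂]

/-- The distribution term `δ(0)`. -/
def DTerm.deltaNil : DTerm (paSig A) V D :=
  .dirac (.op (S := paSig A) PAOp.nil Fin.elim0)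

/-- The distribution term `θ₁ ⊕_p θ₂`, with weight `p` on `θ₁` and `1 - p` on `θ₂`. -/
def DTerm.choice (p : Set.Ioo (0 : ℝ≥0) 1) (θ₁ θ₂ : DTerm (paSig A) V D) :
    DTerm (paSig A) V D :=
  .sum (Fin 2) (PMF.ofFintype ![(p.1 : ℝ≥0∞), 1 - (p.1 : ℝ≥0∞)] (by
      have h : (p.1 : ℝ≥0∞) ≤ 1 := by exact_mod_cast p.2.2.le
      simpa [Fin.sum_univ_two] using add_tsub_cancel_of_le h))
    (by
      have h0 : (p.1 : ℝ≥0∞) ≠ 0 := by exact_mod_cast p.2.1.ne'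
      have h1 : (p.1 : ℝ≥0∞) < 1 := by exact_mod_cast p.2.2
      intro i
      fin_cases i
      · simpa using h0
      · simpa using (tsub_pos_of_lt h1).ne')
    ![θ₁, θ₂]

/-- The rule of a binary operator with premise `x -a→ μ` and conclusion label `a`. -/
def ruleL (a : A) (θ : DTerm (paSig A) (Fin 2) (Fin 1)) : Rule (paSig A) A 2 :=
  ⟨1, ![(0, a)], 0, ![], a, θ⟩

/-- The rule of a binary operator with premise `y -a→ ν` and conclusion label `a`. -/
def ruleR (a : A) (θ : DTerm (paSig A) (Fin 2) (Fin 1)) : Rule (paSig A) A 2 :=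
  ⟨1, ![(1, a)], 0, ![], a, θ⟩

/-- The rule of a binary operator with premises `x -a→ μ` and `y -a↛` and conclusion label `a`. -/
def ruleLNeg (a : A) (θ : DTerm (paSig A) (Fin 2) (Fin 1)) : Rule (paSig A) A 2 :=
  ⟨1, ![(0, a)], 1, ![(1, a)], a, θ⟩

/-- The rule of a binary operator with premises `x -a↛` and `y -a→ ν` and conclusion label `a`. -/
def ruleRNeg (a : A) (θ : DTerm (paSig A) (Fin 2) (Fin 1)) : Rule (paSig A) A 2 :=
  ⟨1, ![(1, a)], 1, ![(0, a)], a, θ⟩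

/-- The rule of a binary operator with premises `x -b→ μ` and `y -a→ ν` and conclusion label `a`. -/
def ruleLR (b a : A) (θ : DTerm (paSig A) (Fin 2) (Fin 2)) : Rule (paSig A) A 2 :=
  ⟨2, ![(0, b), (1, a)], 0, ![], a, θ⟩

/-- The distribution term `δ(x)` for the source variable `x = x₀`. -/
def dx : DTerm (paSig A) (Fin 2) D := .dirac (.var 0)

/-- The distribution term `δ(y)` for the source variable `y = x₁`. -/
def dy : DTerm (paSig A) (Fin 2) D := .dirac (.var 1)

/-- The rules with conclusion label `a` of the operators of the probabilistic process algebra, where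
`tick` is the action of successful termination. In rules with one positive premise the distribution
variable is `.var 0`; in rules with two, `.var 0` belongs to `x` and `.var 1` to `y`. -/
def paRules (tick a : A) : {n : ℕ} → PAOp A n → Set (Rule (paSig A) A n)
  | _, .nil => ∅
  | _, .skip => {r | a = tick ∧ r = ⟨0, ![], 0, ![], tick, .deltaNil⟩}
  | n, .pre b p hp => {r | a = b ∧
      r = ⟨0, ![], 0, ![], b, .sum (Fin n) p hp fun i => .dirac (.var i)⟩}
  | _, .seq => {r |
      (a ≠ tick ∧ r = ruleL a (.bin .seq (.var 0) dy)) ∨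
      r = ruleLR tick a (.var 1)}
  | _, .alt => {r | r = ruleL a (.var 0) ∨ r = ruleR a (.var 0)}
  | _, .palt p => {r |
      r = ruleLNeg a (.var 0) ∨
      r = ruleRNeg a (.var 0) ∨
      r = ruleLR a a (.choice p (.var 0) (.var 1))}
  | _, .sync => {r |
      (a ≠ tick ∧ r = ruleLR a a (.bin .sync (.var 0) (.var 1))) ∨
      (a = tick ∧ r = ruleLR a a .deltaNil)}
  | _, .async => {r |
      (a ≠ tick ∧ r = ruleL a (.bin .async (.var 0) dy)) ∨
      (a ≠ tick ∧ r = ruleR a (.bin .async dx (.var 0))) ∨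
      (a = tick ∧ r = ruleLR a a .deltaNil)}
  | _, .pasync p => {r |
      (a ≠ tick ∧ r = ruleLNeg a (.bin (.pasync p) (.var 0) dy)) ∨
      (a ≠ tick ∧ r = ruleRNeg a (.bin (.pasync p) dx (.var 0))) ∨
      (a ≠ tick ∧ r = ruleLR a a
        (.choice p (.bin (.pasync p) (.var 0) dy) (.bin (.pasync p) dx (.var 1)))) ∨
      (a = tick ∧ r = ruleLR a a .deltaNil)}
  | _, .csp B => {r |
      (a ∈ B ∧ a ≠ tick ∧ r = ruleLR a a (.bin (.csp B) (.var 0) (.var 1))) ∨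
      (a = tick ∧ r = ruleLR a a .deltaNil) ∨
      (a ∉ B ∧ a ≠ tick ∧ r = ruleL a (.bin (.csp B) (.var 0) dy)) ∨
      (a ∉ B ∧ a ≠ tick ∧ r = ruleR a (.bin (.csp B) dx (.var 0)))}

theorem paRules_act (tick a : A) {n : ℕ} (f : PAOp A n) (r : Rule (paSig A) A n)
    (hr : r ∈ paRules tick a f) : r.act = a := by
  cases f <;> simp only [paRules, Set.mem_ofPred_eq, Set.mem_empty_iff_false] at hr <;>
    grind [ruleL, ruleR, ruleLNeg, ruleRNeg, ruleLR]

theorem finite_setOf_and_eq {X : Type u} (c : Prop) (x : X) : {r | c ∧ r = x}.Finite :=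
  (Set.finite_singleton x).subset fun _ h => h.2

theorem paRules_finite (tick a : A) {n : ℕ} (f : PAOp A n) : (paRules tick a f).Finite := by
  cases f <;>
    simp [paRules, Set.ofPred_or, Set.finite_union, finite_setOf_and_eq, ← and_assoc]

/-- The specification of the probabilistic process algebra. -/
def paPTSS (tick : A) : PTSS.{w} A where
  sig := paSig A
  rules f := ⋃ a, paRules tick a f
  finite_rules f a := by
    refine (paRules_finite tick a f).subset ?_
    rintro r ⟨hr, rfl⟩
    obtain ⟨b, hb⟩ := Set.mem_iUnion.1 hr
    rwa [paRules_act tick b f r hb]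

end PA

end

/-!
The `lam`-bisimulation metrics of an image-finite system are the pseudometrics that are pre-fixed
points of a monotone functional `F`, the Hausdorff lifting of `lam • kantorovich d` to sets of
successors, cut off at `1`. Since matchings can be glued along a common marginal, `F` preserves
pseudometrics. Pseudometrics are also closed under pointwise suprema, so the least pre-fixed point
of `F` among all functions is already a pseudometric, hence the bisimilarity metric `d`.

Being a fixed point, `d` satisfies `d s t = F d s t`, so distances between composed processes can
be estimated by matching single transitions. For probabilistic choice this uses that the
Kantorovich lifting is jointly convex, and for its negative premises that processes at distance less
than `1` have the same enabled actions.
-/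

/-! ### Expectations and conditional distributions -/

section Expectation

variable {α : Type u} {β : Type v}

/-- The expectation of the extended nonnegative function `g` under the discrete distribution `p`,
with the factors in the order used in `kantorovich`. -/
noncomputable def expectation (p : PMF α) (g : α → ℝ≥0∞) : ℝ≥0∞ := ∑' x, g x * p x

theorem expectation_pure (a : α) (g : α → ℝ≥0∞) : expectation (PMF.pure a) g = g a := by
  classical
  simp [expectation, PMF.pure_apply]

theorem expectation_bind (p : PMF α) (f : α → PMF β) (g : β → ℝ≥0∞) :
    expectation (p.bind f) g = expectation p fun x => expectation (f x) g := by
  simp only [expectation, PMF.bind_apply, ← ENNReal.tsum_mul_left, ← ENNReal.tsum_mul_right]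
  rw [ENNReal.tsum_comm]
  exact tsum_congr fun x => tsum_congr fun y => by ring

theorem expectation_map (p : PMF α) (f : α → β) (g : β → ℝ≥0∞) :
    expectation (p.map f) g = expectation p (g ∘ f) := by
  rw [← PMF.bind_pure_comp, expectation_bind]
  exact congrArg _ (funext fun x => expectation_pure (f x) g)

theorem expectation_mono (p : PMF α) {g g' : α → ℝ≥0∞} (h : ∀ x ∈ p.support, g x ≤ g' x) :
    expectation p g ≤ expectation p g' := by
  refine ENNReal.tsum_le_tsum fun x => ?_
  by_cases hx : p x = 0
  · simp [hx]
  · exact mul_le_mul_left (h x ((p.mem_support_iff x).2 hx)) _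

theorem expectation_add (p : PMF α) (g g' : α → ℝ≥0∞) :
    (expectation p fun x => g x + g' x) = expectation p g + expectation p g' := by
  simp only [expectation, add_mul]
  exact ENNReal.tsum_add

theorem mul_expectation (p : PMF α) (c : ℝ≥0∞) (g : α → ℝ≥0∞) :
    c * expectation p g = expectation p fun x => c * g x := by
  simp only [expectation, mul_assoc, ENNReal.tsum_mul_left]

theorem expectation_const (p : PMF α) (c : ℝ≥0∞) : (expectation p fun _ => c) = c := by
  simp [expectation, ENNReal.tsum_mul_left, p.tsum_coe]

theorem expectation_le_iSup (p : PMF α) (g : α → ℝ≥0∞) : expectation p g ≤ ⨆ x, g x :=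
  (expectation_mono p fun x _ => le_iSup g x).trans (expectation_const p _).le

open Classical in
/-- The conditional distribution of `p` given that `f` takes the value `b`. If this event has
probability `0`, the value is `p` itself. -/
noncomputable def condDist (p : PMF α) (f : α → β) (b : β) : PMF α :=
  if h : ∃ a ∈ f ⁻¹' {b}, a ∈ p.support then p.filter (f ⁻¹' {b}) h else p

theorem map_apply_mul_condDist_apply (p : PMF α) (f : α → β) (b : β) (a : α) :
    p.map f b * condDist p f b a = (f ⁻¹' {b}).indicator p a := by
  have hmap : p.map f b = ∑' x, (f ⁻¹' {b}).indicator p x := by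
    rw [← PMF.toOuterMeasure_apply_singleton, PMF.toOuterMeasure_map_apply,
      PMF.toOuterMeasure_apply]
  by_cases hb : b ∈ (p.map f).support
  · obtain ⟨x, hx, hxb⟩ := (PMF.mem_support_map_iff _ _ _).1 hb
    rw [condDist, dif_pos ⟨x, hxb, hx⟩, PMF.filter_apply, ← hmap, mul_left_comm,
      ENNReal.mul_inv_cancel ((PMF.mem_support_iff _ _).1 hb) (PMF.apply_ne_top _ _), mul_one]
  · have hzero : p.map f b = 0 := (PMF.apply_eq_zero_iff _ _).2 hb
    rw [hzero, zero_mul]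
    exact (ENNReal.tsum_eq_zero.1 (hmap.symm.trans hzero) a).symm

theorem bind_condDist (p : PMF α) (f : α → β) : (p.map f).bind (condDist p f) = p := by
  ext a
  simp only [PMF.bind_apply, map_apply_mul_condDist_apply]
  have hne : ∀ b ≠ f a, (f ⁻¹' {b}).indicator p a = 0 := fun b hb =>
    Set.indicator_of_notMem (s := f ⁻¹' {b}) (fun h => hb h.symm) p
  exact (tsum_eq_single (f a) hne).trans (Set.indicator_of_mem (s := f ⁻¹' {f a}) rfl p)

theorem apply_eq_of_mem_support_condDist {p : PMF α} {f : α → β} {a : α} {b : β}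
    (hb : b ∈ (p.map f).support) (ha : a ∈ (condDist p f b).support) : f a = b := by
  have hne : (f ⁻¹' {b}).indicator p a ≠ 0 := by
    rw [← map_apply_mul_condDist_apply]
    exact mul_ne_zero ((PMF.mem_support_iff _ _).1 hb) ((PMF.mem_support_iff _ _).1 ha)
  exact show a ∈ f ⁻¹' {b} from Set.mem_of_indicator_ne_zero hne

end Expectation

/-! ### The Kantorovich lifting -/

section Kantorovich

variable {X : Type u} {d d' : X → X → ℝ≥0∞}

theorem matchings_nonempty (π π' : PMF X) : (matchings π π').Nonempty := by
  refine ⟨π.bind fun x => π'.map (Prod.mk x), ?_, ?_⟩ <;>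
    simp only [PMF.map_bind, PMF.map_comp, Function.comp_def]
  · exact (congrArg π.bind (funext fun x => PMF.map_const π' x)).trans π.bind_pure
  · exact (congrArg π.bind (funext fun _ => PMF.map_id π')).trans (PMF.bind_const π π')

theorem kantorovich_le_expectation {π π' : PMF X} {ω : PMF (X × X)} (hω : ω ∈ matchings π π') :
    kantorovich d π π' ≤ expectation ω fun x => d x.1 x.2 :=
  iInf₂_le ω hω

theorem exists_matching_expectation_le_add (d : X → X → ℝ≥0∞) (π π' : PMF X) {ε : ℝ≥0∞}
    (hε : ε ≠ 0) :
    ∃ ω ∈ matchings π π', (expectation ω fun x => d x.1 x.2) ≤ kantorovich d π π' + ε := by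
  rcases eq_or_ne (kantorovich d π π') ⊤ with htop | htop
  · obtain ⟨ω, hω⟩ := matchings_nonempty π π'
    exact ⟨ω, hω, by simp [htop]⟩
  · have hlt : kantorovich d π π' < kantorovich d π π' + ε := ENNReal.lt_add_right htop hε
    obtain ⟨ω, h⟩ := iInf_lt_iff.1 hlt
    obtain ⟨hω, h⟩ := iInf_lt_iff.1 h
    exact ⟨ω, hω, h.le⟩

theorem kantorovich_mono (h : d ≤ d') (π π' : PMF X) :
    kantorovich d π π' ≤ kantorovich d' π π' :=
  iInf₂_mono fun ω _ => expectation_mono ω fun x _ => h x.1 x.2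

theorem kantorovich_self (hd : ∀ x, d x x = 0) (π : PMF X) : kantorovich d π π = 0 := by
  have hω : π.map (fun x => (x, x)) ∈ matchings π π := by
    constructor <;> rw [PMF.map_comp] <;> exact PMF.map_id π
  refine le_antisymm ((kantorovich_le_expectation hω).trans ?_) zero_le
  rw [expectation_map]
  simp [expectation, hd]

theorem kantorovich_pure_le (x y : X) : kantorovich d (PMF.pure x) (PMF.pure y) ≤ d x y := by
  have hω : PMF.pure (x, y) ∈ matchings (PMF.pure x) (PMF.pure y) :=
    ⟨PMF.pure_map _ _, PMF.pure_map _ _⟩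
  exact (kantorovich_le_expectation hω).trans (expectation_pure _ _).le

theorem kantorovich_bind_le {I : Type v} (p : PMF I) (μ ν : I → PMF X) :
    kantorovich d (p.bind μ) (p.bind ν) ≤ expectation p fun i => kantorovich d (μ i) (ν i) := by
  refine ENNReal.le_of_forall_pos_le_add fun ε hε _ => ?_
  choose ω hω hcost using fun i =>
    exists_matching_expectation_le_add d (μ i) (ν i) (ENNReal.coe_ne_zero.2 hε.ne')
  have hbind : p.bind ω ∈ matchings (p.bind μ) (p.bind ν) := by
    constructor <;> rw [PMF.map_bind]
    · exact congrArg p.bind (funext fun i => (hω i).1)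
    · exact congrArg p.bind (funext fun i => (hω i).2)
  calc kantorovich d (p.bind μ) (p.bind ν)
      ≤ expectation (p.bind ω) fun x => d x.1 x.2 := kantorovich_le_expectation hbind
    _ = expectation p fun i => expectation (ω i) fun x => d x.1 x.2 := expectation_bind _ _ _
    _ ≤ expectation p fun i => kantorovich d (μ i) (ν i) + ε :=
      expectation_mono p fun i _ => hcost i
    _ = (expectation p fun i => kantorovich d (μ i) (ν i)) + ε := by
      rw [expectation_add, expectation_const]

/-- The gluing of two matchings with common marginal `π`: draw the middle point from `π` and then,
independently, the two outer points from the conditional distributions. -/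
noncomputable def glue (π : PMF X) (ω ω' : PMF (X × X)) : PMF (X × X) :=
  π.bind fun y => (condDist ω Prod.snd y).bind fun u =>
    (condDist ω' Prod.fst y).map fun v => (u.1, v.2)

theorem glue_mem_matchings {π₁ π₂ π₃ : PMF X} {ω ω' : PMF (X × X)} (hω : ω ∈ matchings π₁ π₂)
    (hω' : ω' ∈ matchings π₂ π₃) : glue π₂ ω ω' ∈ matchings π₁ π₃ := by
  have hbind : π₂.bind (condDist ω Prod.snd) = ω := hω.2 ▸ bind_condDist ω Prod.snd
  have hbind' : π₂.bind (condDist ω' Prod.fst) = ω' := hω'.1 ▸ bind_condDist ω' Prod.fst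
  constructor
  · rw [← hω.1, ← congrArg (PMF.map Prod.fst) hbind]
    simp only [glue, PMF.map_bind, PMF.map_comp, Function.comp_def]
    refine congrArg π₂.bind (funext fun y => ?_)
    rw [← PMF.bind_pure_comp]
    exact congrArg _ (funext fun u => PMF.map_const _ _)
  · rw [← hω'.2, ← congrArg (PMF.map Prod.snd) hbind']
    simp only [glue, PMF.map_bind, PMF.map_comp, Function.comp_def]
    exact congrArg π₂.bind (funext fun y => PMF.bind_const _ _)

theorem expectation_glue_le (hd : ∀ x y z, d x y ≤ d x z + d z y) {π₁ π₂ π₃ : PMF X}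
    {ω ω' : PMF (X × X)} (hω : ω ∈ matchings π₁ π₂) (hω' : ω' ∈ matchings π₂ π₃) :
    (expectation (glue π₂ ω ω') fun x => d x.1 x.2) ≤
      (expectation ω fun x => d x.1 x.2) + expectation ω' fun x => d x.1 x.2 := by
  obtain rfl := hω.2
  have hfst := hω'.1
  calc
    _ = expectation (ω.map Prod.snd) fun y => expectation (condDist ω Prod.snd y) fun u =>
          expectation (condDist ω' Prod.fst y) fun v => d u.1 v.2 := by
      simp only [glue, expectation_bind, expectation_map, Function.comp_def]
    _ ≤ expectation (ω.map Prod.snd) fun y => expectation (condDist ω Prod.snd y) fun u =>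
          expectation (condDist ω' Prod.fst y) fun v => d u.1 u.2 + d v.1 v.2 := by
      refine expectation_mono _ fun y hy => expectation_mono _ fun u hu =>
        expectation_mono _ fun v hv => ?_
      rw [apply_eq_of_mem_support_condDist hy hu,
        apply_eq_of_mem_support_condDist (hfst.symm ▸ hy) hv]
      exact hd _ _ _
    _ = _ := by
      simp only [expectation_add, expectation_const]
      rw [← expectation_bind, ← expectation_bind, bind_condDist, ← hfst, bind_condDist]

theorem kantorovich_triangle (hd : ∀ x y z, d x y ≤ d x z + d z y) (π₁ π₂ π₃ : PMF X) :
    kantorovich d π₁ π₃ ≤ kantorovich d π₁ π₂ + kantorovich d π₂ π₃ :=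
  ENNReal.le_iInf₂_add_iInf₂ fun _ hω _ hω' =>
    (kantorovich_le_expectation (glue_mem_matchings hω hω')).trans (expectation_glue_le hd hω hω')

end Kantorovich

/-! ### The bisimilarity metric as a least fixed point -/

section Bisimilarity

variable {X : Type u} {A : Type w} {M : PTS X A} {lam : ℝ≥0} {d d' : X → X → ℝ≥0∞} {s t : X}

/-- A transition system is image-finite if every state has finitely many transitions with each
label. -/
def PTS.ImageFinite (M : PTS X A) : Prop := ∀ t a, {π | M t a π}.Finite

/-- The directed Hausdorff lifting of `lam • kantorovich d`: how far `t` is from matching the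
transitions of `s`. It is `⊤` if `s` has a transition with a label that is not enabled in `t`. -/
noncomputable def simulationDistance (M : PTS X A) (lam : ℝ≥0) (d : X → X → ℝ≥0∞) (s t : X) :
    ℝ≥0∞ :=
  ⨆ (a) (π) (_ : M s a π), ⨅ (π') (_ : M t a π'), (lam : ℝ≥0∞) * kantorovich d π π'

theorem le_simulationDistance {a : A} {π : PMF X} (hπ : M s a π) :
    ⨅ (π') (_ : M t a π'), (lam : ℝ≥0∞) * kantorovich d π π' ≤ simulationDistance M lam d s t :=
  le_iSup₂_of_le a π (le_iSup_of_le hπ le_rfl)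

theorem simulationDistance_le {r : ℝ≥0∞}
    (h : ∀ a π, M s a π → ∃ π', M t a π' ∧ (lam : ℝ≥0∞) * kantorovich d π π' ≤ r) :
    simulationDistance M lam d s t ≤ r := by
  refine iSup₂_le fun a π => iSup_le fun hπ => ?_
  obtain ⟨π', hπ', hr⟩ := h a π hπ
  exact iInf₂_le_of_le π' hπ' hr

theorem exists_transition_of_simulationDistance_lt {r : ℝ≥0∞}
    (h : simulationDistance M lam d s t < r) {a : A} {π : PMF X} (hπ : M s a π) :
    ∃ π', M t a π' ∧ (lam : ℝ≥0∞) * kantorovich d π π' < r := by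
  simpa only [iInf_lt_iff, exists_prop] using (le_simulationDistance hπ).trans_lt h

theorem PTS.ImageFinite.exists_transition_le_simulationDistance (hM : M.ImageFinite)
    (h : simulationDistance M lam d s t < ⊤) {a : A} {π : PMF X} (hπ : M s a π) :
    ∃ π', M t a π' ∧ (lam : ℝ≥0∞) * kantorovich d π π' ≤ simulationDistance M lam d s t := by
  obtain ⟨π₀, hπ₀, -⟩ := exists_transition_of_simulationDistance_lt h hπ
  obtain ⟨π', hπ', hmin⟩ := Set.exists_min_image {π' | M t a π'}
    (fun π' => (lam : ℝ≥0∞) * kantorovich d π π') (hM t a) ⟨π₀, hπ₀⟩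
  exact ⟨π', hπ', (le_iInf₂ hmin).trans (le_simulationDistance hπ)⟩

theorem simulationDistance_mono (h : d ≤ d') (s t : X) :
    simulationDistance M lam d s t ≤ simulationDistance M lam d' s t :=
  iSup₂_mono fun _ π => iSup_mono fun _ => iInf₂_mono fun π' _ =>
    mul_le_mul_right (kantorovich_mono h π π') _

theorem simulationDistance_self (hd : ∀ x, d x x = 0) (s : X) :
    simulationDistance M lam d s s = 0 :=
  le_antisymm (simulationDistance_le fun _ π hπ => ⟨π, hπ, by simp [kantorovich_self hd]⟩) zero_le

theorem simulationDistance_triangle (hd : ∀ x y z, d x y ≤ d x z + d z y) (s t q : X) :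
    simulationDistance M lam d s t ≤
      simulationDistance M lam d s q + simulationDistance M lam d q t := by
  refine iSup₂_le fun a π => iSup_le fun hπ => ?_
  calc ⨅ (π'') (_ : M t a π''), (lam : ℝ≥0∞) * kantorovich d π π''
      ≤ ⨅ (π') (_ : M q a π'),
          ((lam : ℝ≥0∞) * kantorovich d π π' + simulationDistance M lam d q t) := by
        refine le_iInf₂ fun π' hπ' => ?_
        refine le_trans ?_ (add_le_add_right (le_simulationDistance hπ') _)
        rw [ENNReal.add_iInf₂]
        refine iInf₂_mono fun π'' _ => ?_
        rw [← mul_add]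
        exact mul_le_mul_right (kantorovich_triangle hd π π' π'') _
    _ = (⨅ (π') (_ : M q a π'), (lam : ℝ≥0∞) * kantorovich d π π') +
          simulationDistance M lam d q t := (ENNReal.iInf₂_add _).symm
    _ ≤ simulationDistance M lam d s q + simulationDistance M lam d q t :=
        add_le_add_left (le_simulationDistance hπ) _

/-- The bisimulation functional, the symmetric Hausdorff lifting of `lam • kantorovich d` cut off
at `1`. Its least fixed point is the bisimilarity metric of an image-finite system. -/
noncomputable def bisimulationFunctional (M : PTS X A) (lam : ℝ≥0) :
    (X → X → ℝ≥0∞) →o (X → X → ℝ≥0∞) where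
  toFun d s t := 1 ⊓ (simulationDistance M lam d s t ⊔ simulationDistance M lam d t s)
  monotone' _ _ h s t := inf_le_inf_left _
    (sup_le_sup (simulationDistance_mono h s t) (simulationDistance_mono h t s))

theorem bisimulationFunctional_apply :
    bisimulationFunctional M lam d s t =
      1 ⊓ (simulationDistance M lam d s t ⊔ simulationDistance M lam d t s) :=
  rfl

theorem isPseudometric_bisimulationFunctional (hd : IsPseudometric d) :
    IsPseudometric (bisimulationFunctional M lam d) where
  le_one _ _ := inf_le_left
  self t := by simp [bisimulationFunctional_apply, simulationDistance_self hd.self]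
  symm s t := by simp only [bisimulationFunctional_apply, sup_comm]
  triangle s t q := by
    have hst := simulationDistance_triangle (M := M) (lam := lam) hd.triangle s t q
    have hts := simulationDistance_triangle (M := M) (lam := lam) hd.triangle t s q
    rw [add_comm] at hts
    simp only [bisimulationFunctional_apply]
    refine (inf_le_inf_left 1 (sup_le (hst.trans (add_le_add le_sup_left le_sup_left))
      (hts.trans (add_le_add le_sup_right le_sup_right)))).trans ?_
    exact (min_add_distrib _ _ _).trans_le inf_le_right

theorem isPseudometric_sSup {D : Set (X → X → ℝ≥0∞)} (hD : ∀ d ∈ D, IsPseudometric d) :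
    IsPseudometric (sSup D) := by
  have hle : ∀ d ∈ D, ∀ s t, d s t ≤ sSup D s t := fun d hd s t => le_sSup hd s t
  have hlub : ∀ s t c, (∀ d ∈ D, d s t ≤ c) → sSup D s t ≤ c := fun s t c h => by
    rw [sSup_apply, iSup_apply]
    exact iSup_le fun d => h d d.2
  have hsymm : ∀ s t, sSup D s t ≤ sSup D t s := fun s t =>
    hlub s t _ fun d hd => ((hD d hd).symm s t).trans_le (hle d hd t s)
  exact {
    le_one := fun s t => hlub s t _ fun d hd => (hD d hd).le_one s t
    self := fun t => le_antisymm (hlub t t _ fun d hd => ((hD d hd).self t).le) zero_le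
    symm := fun s t => le_antisymm (hsymm s t) (hsymm t s)
    triangle := fun s t q => hlub s t _ fun d hd =>
      ((hD d hd).triangle s t q).trans (add_le_add (hle d hd s q) (hle d hd q t)) }

theorem isBisimulationMetric_iff (hM : M.ImageFinite) :
    IsBisimulationMetric M lam d ↔ IsPseudometric d ∧ bisimulationFunctional M lam d ≤ d := by
  constructor
  · refine fun h => ⟨h.pseudometric, fun s t => ?_⟩
    rcases lt_or_ge (d s t) 1 with hst | hst
    · have hts : d t s = d s t := h.pseudometric.symm t s
      exact inf_le_of_right_le (sup_le (simulationDistance_le (h.transfer s t hst))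
        (hts ▸ simulationDistance_le (h.transfer t s (hts ▸ hst))))
    · exact inf_le_of_left_le hst
  · rintro ⟨hd, hpre⟩
    refine ⟨hd, fun s t hst a π hπ => ?_⟩
    have hle : simulationDistance M lam d s t ≤ d s t :=
      le_sup_left.trans ((inf_le_iff.1 (hpre s t)).resolve_left hst.not_ge)
    obtain ⟨π', hπ', h⟩ := hM.exists_transition_le_simulationDistance
      (hle.trans_lt (hst.trans ENNReal.one_lt_top)) hπ
    exact ⟨π', hπ', h.trans hle⟩

theorem isPseudometric_lfp_bisimulationFunctional :
    IsPseudometric (bisimulationFunctional M lam).lfp :=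
  OrderHom.lfp_induction _ (fun _ hd _ => isPseudometric_bisimulationFunctional hd)
    fun _ => isPseudometric_sSup

theorem isLeast_lfp_bisimulationFunctional (hM : M.ImageFinite) :
    IsLeast {d | IsBisimulationMetric M lam d} (bisimulationFunctional M lam).lfp :=
  ⟨(isBisimulationMetric_iff hM).2
      ⟨isPseudometric_lfp_bisimulationFunctional, (OrderHom.map_lfp _).le⟩,
    fun _ hd => OrderHom.lfp_le _ ((isBisimulationMetric_iff hM).1 hd).2⟩

theorem bisimilarityMetric_eq_lfp (hM : M.ImageFinite) :
    bisimilarityMetric M lam = (bisimulationFunctional M lam).lfp :=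
  (isLeast_lfp_bisimulationFunctional hM).isGLB.sInf_eq

theorem isLeast_bisimilarityMetric (hM : M.ImageFinite) :
    IsLeast {d | IsBisimulationMetric M lam d} (bisimilarityMetric M lam) :=
  bisimilarityMetric_eq_lfp (lam := lam) hM ▸ isLeast_lfp_bisimulationFunctional hM

theorem bisimilarityMetric_apply (hM : M.ImageFinite) (s t : X) :
    bisimilarityMetric M lam s t = 1 ⊓ (simulationDistance M lam (bisimilarityMetric M lam) s t ⊔
      simulationDistance M lam (bisimilarityMetric M lam) t s) := by
  rw [← bisimulationFunctional_apply, bisimilarityMetric_eq_lfp hM, OrderHom.map_lfp]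

theorem nonExtensive_of_simulationDistance_le {S : Signature.{u}} {M : PTS (Proc S) A}
    (hM : M.ImageFinite) {n : ℕ} {f : S.Op n}
    (h : ∀ s t : Fin n → Proc S,
      simulationDistance M lam (bisimilarityMetric M lam) (.op f s) (.op f t) ≤
        ⨆ i, simulationDistance M lam (bisimilarityMetric M lam) (s i) (t i) ⊔
          simulationDistance M lam (bisimilarityMetric M lam) (t i) (s i)) :
    NonExtensive (bisimilarityMetric M lam) f := by
  intro s t
  simp only [bisimilarityMetric_apply hM, ← inf_iSup_eq]
  refine inf_le_inf_left _ (sup_le (h s t) ?_)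
  simpa only [sup_comm] using h t s

end Bisimilarity

/-! ### Transitions of composed processes -/

theorem PTSS.imageFinite_model {A : Type w} (P : PTSS.{u} A) : P.model.ImageFinite := by
  intro t
  induction t with
  | var x => exact x.elim
  | op f ts ih =>
    intro a
    refine ((P.finite_rules f a).biUnion fun r _ =>
      (Set.Finite.pi fun j => ih (r.pos j).1 (r.pos j).2).image (r.target.eval ts)).subset ?_
    intro π hπ
    rw [Set.mem_ofPred_eq, PTSS.model] at hπ
    obtain ⟨r, hr, ρ, hp, -, ha, rfl⟩ := hπ
    exact Set.mem_biUnion (show r ∈ {r ∈ P.rules f | r.act = a} from ⟨hr, ha.symm⟩)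
      ⟨ρ, fun j _ => hp j, rfl⟩

/-- The distribution on `Fin 2` with weights `p` and `1 - p`, which `DTerm.choice` uses for the
convex combination. -/
noncomputable def choiceWeights (p : Set.Ioo (0 : ℝ≥0) 1) : PMF (Fin 2) :=
  PMF.ofFintype ![(p.1 : ℝ≥0∞), 1 - (p.1 : ℝ≥0∞)] (by
    have h : (p.1 : ℝ≥0∞) ≤ 1 := by exact_mod_cast p.2.2.le
    simpa [Fin.sum_univ_two] using add_tsub_cancel_of_le h)

theorem mem_paPTSS_rules {A : Type w} {tick : A} {n : ℕ} {f : PAOp A n} {r : Rule (paSig A) A n} :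
    r ∈ (paPTSS tick).rules f ↔ r ∈ paRules tick r.act f := by
  refine Set.mem_iUnion.trans ⟨?_, fun hr => ⟨r.act, hr⟩⟩
  rintro ⟨a, hr⟩
  rwa [paRules_act tick a f r hr]

namespace DisjointExtension

theorem model_emb_iff {A : Type w} {P₁ : PTSS.{v} A} {P₂ : PTSS.{u} A}
    (E : DisjointExtension P₁ P₂) {n : ℕ} (f : P₁.sig.Op n) (ts : Fin n → Proc P₂.sig) (a : A)
    (π : PMF (Proc P₂.sig)) :
    P₂.model (.op (E.emb n f) ts) a π ↔ ∃ r ∈ P₁.rules f,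
      ∃ ρ : Fin r.numPos → PMF (Proc P₂.sig),
        (∀ j, P₂.model (ts (r.pos j).1) (r.pos j).2 (ρ j)) ∧
        (∀ l π', ¬ P₂.model (ts (r.neg l).1) (r.neg l).2 π') ∧
        a = r.act ∧ π = (r.target.mapOp E.emb).eval ts ρ := by
  rw [PTSS.model, E.rules_emb f]
  exact Set.exists_mem_image

variable {A : Type w} {tick : A} {P : PTSS.{u} A} (E : DisjointExtension (paPTSS tick) P)

theorem model_emb_paOp_iff {n : ℕ} (f : PAOp A n) (ts : Fin n → Proc P.sig) (a : A)
    (π : PMF (Proc P.sig)) :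
    P.model (.op (E.emb n f) ts) a π ↔ ∃ r ∈ paRules tick a f,
      ∃ ρ : Fin r.numPos → PMF (Proc P.sig),
        (∀ j, P.model (ts (r.pos j).1) (r.pos j).2 (ρ j)) ∧
        (∀ l π', ¬ P.model (ts (r.neg l).1) (r.neg l).2 π') ∧
        π = (r.target.mapOp E.emb).eval ts ρ := by
  refine (E.model_emb_iff f ts a π).trans ?_
  constructor
  · rintro ⟨r, hr, ρ, hpos, hneg, rfl, hπ⟩
    exact ⟨r, mem_paPTSS_rules.1 hr, ρ, hpos, hneg, hπ⟩
  · rintro ⟨r, hr, ρ, hpos, hneg, hπ⟩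
    obtain rfl := paRules_act tick a f r hr
    exact ⟨r, mem_paPTSS_rules.2 hr, ρ, hpos, hneg, rfl, hπ⟩

theorem model_pre_iff {n : ℕ} (b : A) (p : PMF (Fin n)) (hp : ∀ i, p i ≠ 0)
    (ts : Fin n → Proc P.sig) (a : A) (π : PMF (Proc P.sig)) :
    P.model (.op (E.emb n (.pre b p hp)) ts) a π ↔
      a = b ∧ π = p.bind fun i => PMF.pure (ts i) := by
  rw [E.model_emb_paOp_iff]
  constructor
  · rintro ⟨r, ⟨rfl, rfl⟩, ρ, -, -, hπ⟩
    exact ⟨rfl, hπ⟩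
  · rintro ⟨rfl, hπ⟩
    exact ⟨_, ⟨rfl, rfl⟩, Fin.elim0, fun j => j.elim0, fun l => l.elim0, hπ⟩

theorem model_alt_iff (ts : Fin 2 → Proc P.sig) (a : A) (π : PMF (Proc P.sig)) :
    P.model (.op (E.emb 2 .alt) ts) a π ↔ ∃ i, P.model (ts i) a π := by
  rw [E.model_emb_paOp_iff, Fin.exists_fin_two]
  constructor
  · rintro ⟨r, rfl | rfl, ρ, hpos, -, rfl⟩
    · exact Or.inl (hpos (0 : Fin 1))
    · exact Or.inr (hpos (0 : Fin 1))
  · rintro (h | h)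
    · exact ⟨_, Or.inl rfl, fun _ => π, Fin.forall_fin_one.2 h, fun l => l.elim0, rfl⟩
    · exact ⟨_, Or.inr rfl, fun _ => π, Fin.forall_fin_one.2 h, fun l => l.elim0, rfl⟩

theorem eval_mapOp_choice (p : Set.Ioo (0 : ℝ≥0) 1) (ts : Fin 2 → Proc P.sig)
    (ρ : Fin 2 → PMF (Proc P.sig)) :
    ((DTerm.choice p (.var 0) (.var 1) : DTerm (paSig A) (Fin 2) (Fin 2)).mapOp E.emb).eval ts ρ =
      (choiceWeights p).bind ρ := by
  refine congrArg (choiceWeights p).bind (funext fun i => ?_)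
  fin_cases i <;> rfl

theorem model_palt_iff (p : Set.Ioo (0 : ℝ≥0) 1) (ts : Fin 2 → Proc P.sig) (a : A)
    (π : PMF (Proc P.sig)) :
    P.model (.op (E.emb 2 (.palt p)) ts) a π ↔
      (P.model (ts 0) a π ∧ ∀ ν, ¬ P.model (ts 1) a ν) ∨
      ((∀ μ, ¬ P.model (ts 0) a μ) ∧ P.model (ts 1) a π) ∨
      ∃ ρ : Fin 2 → PMF (Proc P.sig), (∀ i, P.model (ts i) a (ρ i)) ∧
        π = (choiceWeights p).bind ρ := by
  rw [E.model_emb_paOp_iff]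
  constructor
  · rintro ⟨r, rfl | rfl | rfl, ρ, hpos, hneg, rfl⟩
    · exact Or.inl ⟨hpos (0 : Fin 1), hneg (0 : Fin 1)⟩
    · exact Or.inr (Or.inl ⟨hneg (0 : Fin 1), hpos (0 : Fin 1)⟩)
    · exact Or.inr (Or.inr ⟨ρ, Fin.forall_fin_two.2 ⟨hpos (0 : Fin 2), hpos (1 : Fin 2)⟩,
        E.eval_mapOp_choice p ts ρ⟩)
  · rintro (⟨hpos, hneg⟩ | ⟨hneg, hpos⟩ | ⟨ρ, hpos, rfl⟩)
    · exact ⟨_, Or.inl rfl, fun _ => π, Fin.forall_fin_one.2 hpos, Fin.forall_fin_one.2 hneg, rfl⟩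
    · exact ⟨_, Or.inr (Or.inl rfl), fun _ => π, Fin.forall_fin_one.2 hpos,
        Fin.forall_fin_one.2 hneg, rfl⟩
    · exact ⟨_, Or.inr (Or.inr rfl), ρ, Fin.forall_fin_two.2 ⟨hpos 0, hpos 1⟩, fun l => l.elim0,
        (E.eval_mapOp_choice p ts ρ).symm⟩

/-! ### Distances between composed processes -/

variable {lam : ℝ≥0} {d : Proc P.sig → Proc P.sig → ℝ≥0∞}

theorem simulationDistance_pre_le {n : ℕ} (b : A) (p : PMF (Fin n)) (hp : ∀ i, p i ≠ 0)
    (s t : Fin n → Proc P.sig) :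
    simulationDistance P.model lam d (.op (E.emb n (.pre b p hp)) s)
      (.op (E.emb n (.pre b p hp)) t) ≤ lam * expectation p fun i => d (s i) (t i) := by
  refine simulationDistance_le fun a π hπ => ?_
  obtain ⟨rfl, rfl⟩ := (E.model_pre_iff b p hp s a π).1 hπ
  exact ⟨_, (E.model_pre_iff _ p hp t _ _).2 ⟨rfl, rfl⟩, mul_le_mul_right
    ((kantorovich_bind_le p _ _).trans
      (expectation_mono p fun i _ => kantorovich_pure_le (s i) (t i))) _⟩

theorem simulationDistance_alt_le (s t : Fin 2 → Proc P.sig) :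
    simulationDistance P.model lam d (.op (E.emb 2 .alt) s) (.op (E.emb 2 .alt) t) ≤
      ⨆ i, simulationDistance P.model lam d (s i) (t i) := by
  refine le_of_forall_gt_imp_ge_of_dense fun r hr => simulationDistance_le fun a π hπ => ?_
  obtain ⟨i, hπ⟩ := (E.model_alt_iff s a π).1 hπ
  obtain ⟨π', hπ', hK⟩ := exists_transition_of_simulationDistance_lt
    ((le_iSup (fun i => simulationDistance P.model lam d (s i) (t i)) i).trans_lt hr) hπ
  exact ⟨π', (E.model_alt_iff t a π').2 ⟨i, hπ'⟩, hK.le⟩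

theorem simulationDistance_palt_le (p : Set.Ioo (0 : ℝ≥0) 1) (s t : Fin 2 → Proc P.sig) :
    simulationDistance P.model lam d (.op (E.emb 2 (.palt p)) s) (.op (E.emb 2 (.palt p)) t) ≤
      ⨆ i, simulationDistance P.model lam d (s i) (t i) ⊔
        simulationDistance P.model lam d (t i) (s i) := by
  refine le_of_forall_gt_imp_ge_of_dense fun r hr => simulationDistance_le fun a π hπ => ?_
  have hlt := fun i => sup_lt_iff.1 ((le_iSup (fun i => simulationDistance P.model lam d (s i) (t i)
    ⊔ simulationDistance P.model lam d (t i) (s i)) i).trans_lt hr)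
  have hmatch : ∀ i μ, P.model (s i) a μ → ∃ μ', P.model (t i) a μ' ∧
      (lam : ℝ≥0∞) * kantorovich d μ μ' < r :=
    fun i _ => exists_transition_of_simulationDistance_lt (hlt i).1
  have hdisabled : ∀ i, (∀ μ, ¬ P.model (s i) a μ) → ∀ μ, ¬ P.model (t i) a μ := fun i hs μ hμ =>
    let ⟨μ', hμ', _⟩ := exists_transition_of_simulationDistance_lt (hlt i).2 hμ
    hs μ' hμ'
  rcases (E.model_palt_iff p s a π).1 hπ with ⟨hπ, hneg⟩ | ⟨hneg, hπ⟩ | ⟨ρ, hρ, rfl⟩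
  · obtain ⟨π', hπ', hK⟩ := hmatch 0 π hπ
    exact ⟨π', (E.model_palt_iff p t a π').2 (Or.inl ⟨hπ', hdisabled 1 hneg⟩), hK.le⟩
  · obtain ⟨π', hπ', hK⟩ := hmatch 1 π hπ
    exact ⟨π', (E.model_palt_iff p t a π').2 (Or.inr (Or.inl ⟨hdisabled 0 hneg, hπ'⟩)), hK.le⟩
  · choose ρ' hρ' hK using fun i => hmatch i (ρ i) (hρ i)
    refine ⟨_, (E.model_palt_iff p t a _).2 (Or.inr (Or.inr ⟨ρ', hρ', rfl⟩)), ?_⟩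
    calc (lam : ℝ≥0∞) * kantorovich d ((choiceWeights p).bind ρ) ((choiceWeights p).bind ρ')
        ≤ lam * expectation (choiceWeights p) fun i => kantorovich d (ρ i) (ρ' i) :=
          mul_le_mul_right (kantorovich_bind_le _ ρ ρ') _
      _ ≤ ⨆ i, lam * kantorovich d (ρ i) (ρ' i) :=
          (mul_expectation _ _ _).trans_le (expectation_le_iSup _ _)
      _ ≤ r := iSup_le fun i => (hK i).le

theorem bisimilarityMetric_pre_le {n : ℕ} (b : A) (p : PMF (Fin n)) (hp : ∀ i, p i ≠ 0)
    (s t : Fin n → Proc P.sig) :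
    bisimilarityMetric P.model lam (.op (E.emb n (.pre b p hp)) s)
      (.op (E.emb n (.pre b p hp)) t) ≤
        lam * expectation p fun i => bisimilarityMetric P.model lam (s i) (t i) := by
  have hsymm := (isLeast_bisimilarityMetric (lam := lam) P.imageFinite_model).1.pseudometric.symm
  rw [bisimilarityMetric_apply P.imageFinite_model]
  refine inf_le_of_right_le (sup_le (E.simulationDistance_pre_le b p hp s t) ?_)
  simp only [fun i => hsymm (s i) (t i)]
  exact E.simulationDistance_pre_le b p hp t s

theorem nonExtensive_pre (hlam : lam ≤ 1) {n : ℕ} (b : A) (p : PMF (Fin n))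
    (hp : ∀ i, p i ≠ 0) :
    NonExtensive (bisimilarityMetric P.model lam) (E.emb n (.pre b p hp)) := fun s t =>
  calc _ ≤ lam * expectation p fun i => bisimilarityMetric P.model lam (s i) (t i) :=
        E.bisimilarityMetric_pre_le b p hp s t
    _ ≤ expectation p fun i => bisimilarityMetric P.model lam (s i) (t i) :=
        mul_le_of_le_one_left zero_le (ENNReal.coe_le_one_iff.2 hlam)
    _ ≤ _ := expectation_le_iSup p _

theorem nonExtensive_alt :
    NonExtensive (bisimilarityMetric P.model lam) (E.emb 2 .alt) :=
  nonExtensive_of_simulationDistance_le P.imageFinite_model fun s t =>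
    (E.simulationDistance_alt_le s t).trans (iSup_mono fun _ => le_sup_left)

theorem nonExtensive_palt (p : Set.Ioo (0 : ℝ≥0) 1) :
    NonExtensive (bisimilarityMetric P.model lam) (E.emb 2 (.palt p)) :=
  nonExtensive_of_simulationDistance_le P.imageFinite_model (E.simulationDistance_palt_le p)

end DisjointExtension

theorem mainTheorem6 {A : Type w} (tick : A) (P : PTSS.{u} A)
    (E : DisjointExtension (paPTSS tick) P) (lam : ℝ≥0) (hlam₀ : 0 < lam) (hlam₁ : lam ≤ 1) :
    IsLeast {d | IsBisimulationMetric P.model lam d} (bisimilarityMetric P.model lam) ∧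
    (∀ (n : ℕ) (a : A) (p : PMF (Fin n)) (hp : ∀ i, p i ≠ 0),
      NonExtensive (bisimilarityMetric P.model lam) (E.emb n (PAOp.pre a p hp))) ∧
    NonExtensive (bisimilarityMetric P.model lam) (E.emb 2 PAOp.alt) ∧
    (∀ p : Set.Ioo (0 : ℝ≥0) 1,
      NonExtensive (bisimilarityMetric P.model lam) (E.emb 2 (PAOp.palt p))) :=
  ⟨isLeast_bisimilarityMetric P.imageFinite_model,
    fun _ a p hp => E.nonExtensive_pre hlam₁ a p hp,
    E.nonExtensive_alt, E.nonExtensive_palt⟩
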